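/- Consider a POMDP $(S,A,Z,T,O,R)$ with a countable state set $S$, finite sets $A$ of actions and $Z$ of observations, transition probabilities $T(s,a,s')=p(s'\mid s,a)$, observation probabilities $O(s',a,z)=p(z\mid s',a)$ and rewards $0\le R(s,a)\le R_{\max}$, and a discount factor $\gamma\in[0,1)$. Let $g:S\times A\times[0,1]\to S\times Z$ be a deterministic simulative model: if $\phi$ is uniform on $[0,1]$, then $g(s,a,\phi)$ has law $p(s',z\mid s,a)=T(s,a,s')\,O(s',a,z)$. A scenario for a belief (probability distribution on $S$) $b_0$ is a sequence $\boldsymbol\phi=(s_0,\phi_1,\phi_2,\dots)$ of independent random variables with $s_0\sim b_0$ and $\phi_i$ uniform on $[0,1]$; simulating actions $a_1,a_2,\dots$ under it gives $(s_t,z_t)=g(s_{t-1},a_t,\phi_t)$ and traces the path $(a_1,z_1,a_2,z_2,\dots)$. The DESPOT of height $D$ for $K$ scenarios is the tree of all paths of at most $D$ steps traced by all action sequences under these scenarios. A policy tree derived from it has the same root, its nodes are nodes of the DESPOT, and each node is either a leaf or an internal node at which exactly one action branch is retained, with all observation branches that the DESPOT has there; $|\pi|$ is the number of internal nodes of $\pi$.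 Let $\Pi_{b_0,D,K}$ be the set of all policy trees derived from the DESPOTs of height $D$ for all possible choices of $K$ scenarios for $b_0$. Fix a default policy (a map from action-observation histories to actions). A policy tree $\pi$ is executed by following its action edges and the edges of the received observations, and by following the default policy from the time when a leaf is reached or an observation not present in $\pi$ is received. Let $$V_\pi(b_0)=\mathbf E\Bigl(\sum_{t=0}^\infty\gamma^tR(s_t,a_{t+1})\Bigr)$$ be the expected total discounted reward of executing $\pi$ in the POMDP from $s_0\sim b_0$, and let $\hat V_\pi(b_0)$ be the average, over $K$ scenarios, of the total discounted rewards of simulating $\pi$ under each of them. Theorem. For all constants $\tau,\alpha\in(0,1)$, every belief $b_0$ and all positive integers $D$ and $K$, with probability at least $1-\tau$ over $K$ scenarios sampled independently for $b_0$, every $\pi\in\Pi_{b_0,D,K}$ simultaneously satisfies $$V_\pi(b_0)\ \ge\ \frac{1-\alpha}{1+\alpha}\,\hat V_\pi(b_0)-\frac{R_{\max}}{(1+\alpha)(1-\gamma)}\cdot\frac{\ln(4/\tau)+|\pi|\ln\bigl(KD|A||Z|\bigr)}{\alpha K}.$$ -/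

import Mathlib

open MeasureTheory ProbabilityTheory unitInterval

/-- A discrete POMDP `(S, A, Z, T, O, R)`: `T s a` is the law of the next state `s'`, `O s' a` is
the law of the observation received after action `a` has led to the new state `s'`, and `R s a` is
the immediate reward. -/
structure POMDP (S A Z : Type*) where
  T : S → A → PMF S
  O : S → A → PMF Z
  R : S → A → ℝ

/-- A (deterministic) policy chooses an action from the history `(a₁, z₁), …, (a_t, z_t)` of actions
and observations, listed from the oldest to the most recent. The belief reached from a given initial
belief is a function of this history, so every map from beliefs to actions is of this form. -/
abbrev HistoryPolicy (A Z : Type*) := List (A × Z) → A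

/-- The situation at one time step: the current hidden state and the history so far. -/
@[ext]
structure Config (S A Z : Type*) where
  state : S
  hist : List (A × Z)

instance {S A Z : Type*} : MeasurableSpace (Config S A Z) := ⊤

instance {S A Z : Type*} : DiscreteMeasurableSpace (Config S A Z) := ⟨fun _ => trivial⟩

namespace POMDP

section TrueValue

variable {S A Z : Type*} (P : POMDP S A Z) (p : HistoryPolicy A Z)

/-- One step of executing the policy `p`: take `a = p(history)`, draw the new state `s'` from
`T s a`, draw the observation `z` from `O s' a`, and append `(a, z)` to the history. -/
noncomputable def step (c : Config S A Z) : PMF (Config S A Z) :=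
  (P.T c.state (p c.hist)).bind fun s' =>
    (P.O s' (p c.hist)).map fun z => ⟨s', c.hist ++ [(p c.hist, z)]⟩

/-- `step` as a transition kernel from the past up to time `n` to time `n + 1`. -/
noncomputable def stepKernel (n : ℕ) :
    Kernel ((i : Finset.Iic n) → (fun _ : ℕ => Config S A Z) i) (Config S A Z) where
  toFun x := (P.step p (x ⟨n, Finset.mem_Iic.2 le_rfl⟩)).toMeasure
  measurable' :=
    (Measurable.of_discrete (f := fun c : Config S A Z => (P.step p c).toMeasure)).comp
      (measurable_pi_apply _)

instance (n : ℕ) : IsMarkovKernel (P.stepKernel p n) :=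
  ⟨fun x => inferInstanceAs
    (IsProbabilityMeasure (P.step p (x ⟨n, Finset.mem_Iic.2 le_rfl⟩)).toMeasure)⟩

/-- The law of the infinite trajectory (state and history at times `0, 1, 2, …`) when the start
state is drawn from the belief `b` and the policy `p` is executed. -/
noncomputable def execution (b : PMF S) : Measure (ℕ → Config S A Z) :=
  Kernel.trajMeasure (X := fun _ => Config S A Z)
    (b.map fun s => (⟨s, []⟩ : Config S A Z)).toMeasure (P.stepKernel p)

/-- The value `V_p(b) = 𝔼 (∑_{t ≥ 0} γ ^ t * R (s_t, a_t))` of the policy `p` at the belief `b`. -/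
noncomputable def value (γ : ℝ) (b : PMF S) : ℝ :=
  ∫ ω, ∑' t : ℕ, γ ^ t * P.R (ω t).state (p (ω t).hist) ∂(P.execution p b)

end TrueValue

/-- `g` is a deterministic simulative model of the POMDP: if `u` is uniform on `[0, 1]`, then
`g s a u` has the law `p (s', z | s, a) = T (s, a, s') * O (s', a, z)`. -/
def IsSimulativeModel {S A Z : Type*} (P : POMDP S A Z) (g : S → A → I → S × Z) : Prop :=
  ∀ s a s' z, MeasurableSet {u : I | g s a u = (s', z)} ∧
    volume {u : I | g s a u = (s', z)} = P.T s a s' * P.O s' a z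

end POMDP

/-- A scenario `(s₀, φ₁, φ₂, …)`: a start state and a sequence of numbers in `[0, 1]`; the number
`φ_{t+1}` is `φ.2 t`. -/
abbrev Scenario (S : Type*) := S × (ℕ → I)

/-- The law of `K` independent scenarios for the belief `b`: start states are drawn from `b`, all
numbers are independent and uniform on `[0, 1]`. -/
noncomputable def scenarioMeasure {S : Type*} [MeasurableSpace S] (b : PMF S) (K : ℕ) :
    Measure (Fin K → Scenario S) :=
  Measure.pi fun _ => b.toMeasure.prod (Measure.infinitePi fun _ : ℕ => (volume : Measure I))

section Simulation

variable {S A Z : Type*} (g : S → A → I → S × Z)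

/-- Simulation of the policy `p` under a scenario: state and history after `t` steps, where
`(s_{t+1}, z_{t+1}) = g (s_t, a_{t+1}, φ_{t+1})`. -/
def simulate (p : HistoryPolicy A Z) (φ : Scenario S) : ℕ → Config S A Z
  | 0 => ⟨φ.1, []⟩
  | t + 1 =>
    let c := simulate p φ t
    let a := p c.hist
    ⟨(g c.state a (φ.2 t)).1, c.hist ++ [(a, (g c.state a (φ.2 t)).2)]⟩

/-- The total discounted reward of the simulation of the policy `p` under one scenario. -/
noncomputable def scenarioValue (R : S → A → ℝ) (γ : ℝ) (p : HistoryPolicy A Z)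
    (φ : Scenario S) : ℝ :=
  ∑' t : ℕ, γ ^ t * R (simulate g p φ t).state (p (simulate g p φ t).hist)

/-- The empirical value of the policy `p`: the average of its total discounted rewards under the
`K` scenarios `Φ`. -/
noncomputable def empiricalValue (R : S → A → ℝ) (γ : ℝ) (p : HistoryPolicy A Z) {K : ℕ}
    (Φ : Fin K → Scenario S) : ℝ :=
  (∑ k, scenarioValue g R γ p (Φ k)) / K

/-- The path `(a₁, z₁), …, (a_n, z_n)` traced out by a finite action sequence from the state `s`
with the random numbers `φ`. -/
def tracedPath : S → (ℕ → I) → List A → List (A × Z)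
  | _, _, [] => []
  | s, φ, a :: as =>
    (a, (g s a (φ 0)).2) :: tracedPath (g s a (φ 0)).1 (fun i => φ (i + 1)) as

/-- The nodes of the DESPOT of height `D` constructed with the scenarios `Φ`. A node is identified
with the sequence of action and observation edges from the root to it; the root is `[]`. -/
def despot (D : ℕ) {K : ℕ} (Φ : Fin K → Scenario S) : Set (List (A × Z)) :=
  {h | ∃ (k : Fin K) (as : List A),
    as.length ≤ D ∧ h = tracedPath g (Φ k).1 (Φ k).2 as}

end Simulation

/-- A policy tree: a leaf, or an internal node with a single action edge `a`, which branches into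
the observation edges in `obs`, each of them leading to a subtree. -/
inductive PolicyTree (A Z : Type*)
  | leaf : PolicyTree A Z
  | node (a : A) (obs : Finset Z) (child : {z // z ∈ obs} → PolicyTree A Z) : PolicyTree A Z

namespace PolicyTree

variable {A Z : Type*}

/-- The size of a policy tree: the number of its internal nodes. -/
def size : PolicyTree A Z → ℕ
  | leaf => 0
  | node _ _ child => 1 + ∑ z, (child z).size

open Classical in
/-- The action at the tree node reached by following the observations of a history, and `none` if
a leaf has been reached or an observation not present in the tree has been met. (The actions in the
history need not be inspected, because an agent that is still inside the tree has followed it.) -/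
noncomputable def action? : PolicyTree A Z → List (A × Z) → Option A
  | leaf, _ => none
  | node a _ _, [] => some a
  | node _ obs child, (_, z) :: h => if hz : z ∈ obs then (child ⟨z, hz⟩).action? h else none

/-- Executing a policy tree: follow the tree, and follow the default policy `δ` from the time when a
leaf is reached or an observation not present in the tree is received. -/
noncomputable def toPolicy (δ : HistoryPolicy A Z) (π : PolicyTree A Z) : HistoryPolicy A Z :=
  fun h => (π.action? h).getD (δ h)

/-- The policy tree, with its root placed at the node `h`, is derived from the belief tree with node
set `N`: leaves are nodes of that tree, and at each internal node exactly one action branch is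
retained, with all its observation branches in that tree (of which there is at least one, since
the node is internal). -/
def DerivedFrom (N : Set (List (A × Z))) : PolicyTree A Z → List (A × Z) → Prop
  | leaf, h => h ∈ N
  | node a obs child, h =>
    h ∈ N ∧ obs.Nonempty ∧ (∀ z, z ∈ obs ↔ h ++ [(a, z)] ∈ N) ∧
      ∀ z, (child z).DerivedFrom N (h ++ [(a, z.1)])

end PolicyTree

/-- The set `Π_{b₀, D, K}` of all policy trees derived from DESPOTs of height `D` constructed with
all possible `K` scenarios for the belief `b₀`. -/
def despotPolicies {S A Z : Type*} (g : S → A → I → S × Z) (b₀ : PMF S) (D K : ℕ) :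
    Set (PolicyTree A Z) :=
  {π | ∃ Φ : Fin K → Scenario S, (∀ k, (Φ k).1 ∈ b₀.support) ∧
    π.DerivedFrom (despot g D Φ) []}

/-! For one fixed policy, the discounted rewards of the `K` scenarios are independent variables in
`[0, Rmax / (1 - γ)]`. Their mean is the true value, because simulation and execution have the same
one-time laws (`map_simulate_eq_map_execution`). A Chernoff bound with parameter `α`
(`measure_pi_relative_deviation_le`) then makes the failure probability at most `exp (-L)`, for any
chosen `L ≥ 0`.

Uniformity comes from a weighted union bound. Trees derived from different scenarios vary in which
observations they contain, but an absent observation acts like a leaf. Each derived tree therefore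
acts like a skeleton of the same size, taken from a finite family that depends only on `A`, `Z` and
`D` (`exists_skeleton`). With `L = log (4 / τ) + size * log N` and `N = K * D * |A| * |Z|`, a
skeleton costs `τ / 4 * N⁻¹ ^ size`. The generating function of skeletons by size is at most `2` at
`1 / N` (`sum_pow_size_le`), so the total cost is at most `τ / 2`. -/

/-! ### Chernoff and relative deviation bounds -/

/-- Already `exp α ≤ 1 / (1 - α)` gives the bound `α / (1 - α)`. The spare factor `1 + α` matches
the deviation threshold used below, so that the mean cancels there. -/
theorem Real.exp_sub_one_le_div {α : ℝ} (h1 : α < 1) :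
    Real.exp α - 1 ≤ α * ((1 + α) / (1 - α)) := by
  have h := Real.one_sub_le_exp_neg α
  have h2 : 0 < 1 - α := by linarith
  have h3 : Real.exp α ≤ 1 / (1 - α) := by
    rw [le_div_iff₀ h2]
    calc Real.exp α * (1 - α) ≤ Real.exp α * Real.exp (-α) := by gcongr
      _ = 1 := by rw [← Real.exp_add]; simp
  have h4 : α * ((1 + α) / (1 - α)) = 1 / (1 - α) - 1 + α ^ 2 / (1 - α) := by
    field_simp; ring
  have : 0 ≤ α ^ 2 / (1 - α) := by positivity
  linarith

/-- Convexity of the exponential on `[0, 1]`, in the form used for Chernoff bounds. -/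
theorem Real.exp_mul_le_one_add_mul {t y : ℝ} (h0 : 0 ≤ y) (h1 : y ≤ 1) :
    Real.exp (t * y) ≤ 1 + y * (Real.exp t - 1) := by
  have := convexOn_exp.2 (Set.mem_univ 0) (Set.mem_univ t) (sub_nonneg.2 h1) h0 (by ring)
  simp only [smul_eq_mul, mul_zero, zero_add, Real.exp_zero, mul_one] at this
  rw [mul_comm t y]; linarith

section Concentration

variable {Ω : Type*} [MeasurableSpace Ω] (ν : Measure Ω) [IsProbabilityMeasure ν]

/-- Replacing the exponential by its chord on `[0, 1]` leaves only the mean of `Y`; then `1 + v ≤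
exp v`. -/
theorem integral_exp_mul_le {Y : Ω → ℝ} (hY : Measurable Y) (h0 : ∀ ω, 0 ≤ Y ω)
    (h1 : ∀ ω, Y ω ≤ 1) (t : ℝ) :
    ∫ ω, Real.exp (t * Y ω) ∂ν ≤ Real.exp ((∫ ω, Y ω ∂ν) * (Real.exp t - 1)) := by
  have hYi : Integrable Y ν := Integrable.of_bound hY.aestronglyMeasurable 1
    (ae_of_all _ fun ω => by rw [Real.norm_eq_abs, abs_of_nonneg (h0 ω)]; exact h1 ω)
  have hi : Integrable (fun ω => 1 + Y ω * (Real.exp t - 1)) ν :=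
    (integrable_const _).add (hYi.mul_const _)
  calc ∫ ω, Real.exp (t * Y ω) ∂ν ≤ ∫ ω, (1 + Y ω * (Real.exp t - 1)) ∂ν :=
        integral_mono_of_nonneg (ae_of_all _ fun ω => (Real.exp_pos _).le) hi
          (ae_of_all _ fun ω => Real.exp_mul_le_one_add_mul (h0 ω) (h1 ω))
    _ = (∫ ω, Y ω ∂ν) * (Real.exp t - 1) + 1 := by
        rw [integral_add (integrable_const _) (hYi.mul_const _), integral_mul_const]
        simp [add_comm]
    _ ≤ _ := Real.add_one_le_exp _

/-- The Chernoff bound for the sum of independent copies of a `[0, 1]`-valued variable. -/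
theorem measureReal_pi_sum_ge_le {Y : Ω → ℝ} (hY : Measurable Y) (h0 : ∀ ω, 0 ≤ Y ω)
    (h1 : ∀ ω, Y ω ≤ 1) (K : ℕ) {t : ℝ} (ht : 0 ≤ t) (ε : ℝ) :
    (Measure.pi fun _ : Fin K => ν).real {ω | ε ≤ ∑ k, Y (ω k)} ≤
      Real.exp (K * ((∫ ω, Y ω ∂ν) * (Real.exp t - 1)) - t * ε) := by
  have hbd : ∀ ω : Fin K → Ω, ‖Real.exp (t * ∑ k, Y (ω k))‖ ≤ Real.exp (t * K) := fun ω => by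
    rw [Real.norm_eq_abs, abs_of_pos (Real.exp_pos _)]
    gcongr
    calc ∑ k, Y (ω k) ≤ ∑ _k : Fin K, (1 : ℝ) := Finset.sum_le_sum fun k _ => h1 _
      _ = K := by simp
  have hm : Measurable fun ω : Fin K → Ω => Real.exp (t * ∑ k, Y (ω k)) := by fun_prop
  have hch := measure_ge_le_exp_mul_mgf (μ := Measure.pi fun _ : Fin K => ν)
    (X := fun ω => ∑ k, Y (ω k)) ε ht
    (Integrable.of_bound hm.aestronglyMeasurable _ (ae_of_all _ hbd))
  refine hch.trans ?_
  have hmgf : mgf (fun ω => ∑ k, Y (ω k)) (Measure.pi fun _ : Fin K => ν) t =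
      (∫ ω, Real.exp (t * Y ω) ∂ν) ^ K := by
    have := integral_fintype_prod_eq_pow (ι := Fin K) (μ := ν) (fun ω => Real.exp (t * Y ω))
    rw [Fintype.card_fin] at this
    rw [mgf, ← this]
    simp_rw [Finset.mul_sum, Real.exp_sum]
  rw [hmgf]
  calc Real.exp (-t * ε) * (∫ ω, Real.exp (t * Y ω) ∂ν) ^ K
      ≤ Real.exp (-t * ε) * Real.exp ((∫ ω, Y ω ∂ν) * (Real.exp t - 1)) ^ K := by
        gcongr
        exact integral_exp_mul_le ν hY h0 h1 t
    _ = _ := by rw [← Real.exp_nat_mul, ← Real.exp_add]; ring_nf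

/-- A one-sided relative deviation bound (after Haussler) for the mean of `K` independent copies of
a `[0, M]`-valued variable. -/
theorem measure_pi_relative_deviation_le {X : Ω → ℝ} (hX : Measurable X) {M : ℝ} (hM : 0 < M)
    (h0 : ∀ ω, 0 ≤ X ω) (h1 : ∀ ω, X ω ≤ M) {K : ℕ} (hK : 0 < K) {α : ℝ}
    (hα : α ∈ Set.Ioo (0 : ℝ) 1) {L : ℝ} (hL : 0 ≤ L) :
    (Measure.pi fun _ : Fin K => ν) {ω | (1 + α) * ∫ ω, X ω ∂ν <
      (1 - α) * ((∑ k, X (ω k)) / K) - M * (L / (α * K))} ≤ ENNReal.ofReal (Real.exp (-L)) := by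
  obtain ⟨ha0, ha1⟩ := hα
  have hb : 0 < 1 - α := by linarith
  have hKr : (0 : ℝ) < K := by exact_mod_cast hK
  set m := ∫ ω, X ω ∂ν with hm
  have hm0 : 0 ≤ m := integral_nonneg h0
  -- The deviation event solved for the normalized sum `∑ X / M`. With Chernoff parameter `α` the
  -- terms in `m` cancel, leaving an exponent of at most `-L / (1 - α) ≤ -L`.
  set ε := (L / α + K * (1 + α) * (m / M)) / (1 - α) with hε
  have hch := measureReal_pi_sum_ge_le ν (Y := fun ω => X ω / M) (hX.div_const M)
    (fun ω => div_nonneg (h0 ω) hM.le) (fun ω => (div_le_one hM).2 (h1 ω)) K ha0.le ε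
  have hsub : {ω : Fin K → Ω | (1 + α) * m <
      (1 - α) * ((∑ k, X (ω k)) / K) - M * (L / (α * K))} ⊆ {ω | ε ≤ ∑ k, X (ω k) / M} := by
    intro ω hω
    simp only [Set.mem_ofPred_eq] at hω ⊢
    rw [hε, div_le_iff₀ hb, ← Finset.sum_div]
    have h2 := mul_lt_mul_of_pos_left hω (div_pos hKr hM)
    have e1 : K / M * ((1 + α) * m) = K * (1 + α) * (m / M) := by ring
    have e2 : K / M * ((1 - α) * ((∑ k, X (ω k)) / K) - M * (L / (α * K))) =
        (∑ k, X (ω k)) / M * (1 - α) - L / α := by field_simp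
    rw [e1, e2] at h2
    linarith
  refine (measure_mono hsub).trans ?_
  rw [← ofReal_measureReal]
  refine ENNReal.ofReal_le_ofReal (hch.trans (Real.exp_le_exp.2 ?_))
  rw [integral_div, ← hm]
  have he := Real.exp_sub_one_le_div ha1
  have h3 : (K : ℝ) * (m / M * (Real.exp α - 1)) ≤
      K * (m / M * (α * ((1 + α) / (1 - α)))) := by gcongr
  have h4 : α * ε = K * (m / M * (α * ((1 + α) / (1 - α)))) + L / (1 - α) := by
    rw [hε]; field_simp; ring
  have h5 : L ≤ L / (1 - α) := by
    rw [le_div_iff₀ hb]; nlinarith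
  linarith

end Concentration

/-! ### Counting policy trees by a generating function -/

section Skeletons

universe u v

/-- Policy trees with at most `d` levels of internal nodes which have an edge for each observation.
-/
def PolicySkeleton (A : Type u) (Z : Type v) : ℕ → Type (max u v)
  | 0 => PUnit
  | d + 1 => Option (A × (Z → PolicySkeleton A Z d))

namespace PolicySkeleton

variable {A Z : Type*} [Fintype Z]

noncomputable instance instFintype [Fintype A] : ∀ d, Fintype (PolicySkeleton A Z d)
  | 0 => inferInstanceAs (Fintype PUnit)
  | d + 1 => by
    classical
    letI := instFintype d
    exact inferInstanceAs (Fintype (Option (A × (Z → PolicySkeleton A Z d))))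

/-- The policy tree of a skeleton. -/
def toTree : ∀ d, PolicySkeleton A Z d → PolicyTree A Z
  | 0, _ => .leaf
  | _ + 1, none => .leaf
  | d + 1, some (a, f) => .node a Finset.univ fun z => toTree d (f z)

/-- The generating function of skeletons by size. -/
theorem sum_pow_size_succ [Fintype A] (x : ℝ) (d : ℕ) :
    ∑ s : PolicySkeleton A Z (d + 1), x ^ (toTree _ s).size =
      1 + Fintype.card A * x * (∑ s : PolicySkeleton A Z d, x ^ (toTree _ s).size) ^
        Fintype.card Z := by
  classical
  have hsize : ∀ (a : A) (f : Z → PolicySkeleton A Z d),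
      x ^ (toTree (d + 1) (some (a, f))).size = x * ∏ z, x ^ (toTree d (f z)).size := by
    intro a f
    rw [toTree, PolicyTree.size, pow_add, pow_one, Finset.prod_pow_eq_pow_sum]
    congr 2
    exact Finset.sum_coe_sort Finset.univ fun z => (toTree d (f z)).size
  have hsum : ∑ f : Z → PolicySkeleton A Z d, ∏ z, x ^ (toTree d (f z)).size =
      (∑ s : PolicySkeleton A Z d, x ^ (toTree d s).size) ^ Fintype.card Z := by
    rw [← Fintype.prod_sum (fun (_ : Z) s => x ^ (toTree d s).size)]
    simp
  calc ∑ s : PolicySkeleton A Z (d + 1), x ^ (toTree _ s).size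
      = ∑ s : Option (A × (Z → PolicySkeleton A Z d)), x ^ (toTree (d + 1) s).size := rfl
    _ = _ := by
      -- A leaf at the root gives `1`; otherwise the root has weight `x`, one of `|A|` actions, and
      -- a freely chosen subtree for each observation.
      rw [Fintype.sum_option, Fintype.sum_prod_type]
      simp_rw [hsize, ← Finset.mul_sum, hsum]
      simp [toTree, PolicyTree.size, mul_left_comm, mul_assoc]

theorem sum_pow_size_le [Fintype A] [Nonempty A] [Nonempty Z] {m D : ℕ} (hm : 0 < m)
    (hDm : D ≤ m) :
    ∑ s : PolicySkeleton A Z D,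
      (1 / (m * Fintype.card A * Fintype.card Z : ℝ)) ^ (toTree _ s).size ≤ 2 := by
  set x : ℝ := 1 / (m * Fintype.card A * Fintype.card Z : ℝ) with hx
  have hmr : (0 : ℝ) < m := by exact_mod_cast hm
  have hA : (0 : ℝ) < Fintype.card A := by exact_mod_cast Fintype.card_pos
  have hZ : (1 : ℝ) ≤ Fintype.card Z := by exact_mod_cast Fintype.card_pos
  have hx0 : 0 ≤ x := by positivity
  have hW0 : ∀ d, 0 ≤ ∑ s : PolicySkeleton A Z d, x ^ (toTree _ s).size :=
    fun d => Finset.sum_nonneg fun s _ => by positivity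
  -- In the form `1 + u / |Z|` the bound survives the power `|Z|` as `exp u`, and `|A| * x = 1 / (m
  -- * |Z|)` restores the form with `exp u / m` in place of `u`.
  have hstep : ∀ d (u : ℝ), 0 ≤ u →
      ∑ s : PolicySkeleton A Z d, x ^ (toTree _ s).size ≤ 1 + u / Fintype.card Z →
      ∑ s : PolicySkeleton A Z (d + 1), x ^ (toTree _ s).size ≤
        1 + (Real.exp u / m) / Fintype.card Z := by
    intro d u hu h
    rw [sum_pow_size_succ]
    have h1 : (∑ s : PolicySkeleton A Z d, x ^ (toTree _ s).size) ^ Fintype.card Z ≤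
        Real.exp u := by
      calc _ ≤ (1 + u / Fintype.card Z) ^ Fintype.card Z := pow_le_pow_left₀ (hW0 d) h _
        _ ≤ Real.exp (u / Fintype.card Z) ^ Fintype.card Z := by
          gcongr; rw [add_comm]; exact Real.add_one_le_exp _
        _ = Real.exp u := by rw [← Real.exp_nat_mul]; congr 1; field_simp
    calc _ ≤ 1 + Fintype.card A * x * Real.exp u := by gcongr
      _ = _ := by rw [hx]; field_simp
  have hzero : ∑ s : PolicySkeleton A Z 0, x ^ (toTree _ s).size ≤ 1 + 0 / Fintype.card Z := by
    change ∑ s : PUnit, x ^ (toTree 0 s : PolicyTree A Z).size ≤ _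
    simp [toTree, PolicyTree.size]
  have hfin : ∀ d (u : ℝ), u ≤ 1 →
      ∑ s : PolicySkeleton A Z d, x ^ (toTree _ s).size ≤ 1 + u / Fintype.card Z →
      ∑ s : PolicySkeleton A Z d, x ^ (toTree _ s).size ≤ 2 := by
    intro d u hu h
    have : u / Fintype.card Z ≤ 1 := by rw [div_le_one (by linarith)]; linarith
    linarith
  have hexp := Real.exp_one_lt_d9
  -- For `m ≥ 3` the value `u = 1` is preserved, since `exp 1 < 3`. For smaller `m` this fails, but
  -- `D ≤ m` leaves at most two iterations from `u = 0`, ending at `1 / m` or `exp (1 / m) / m`.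
  match D, hDm with
  | 0, _ => exact hfin 0 0 zero_le_one hzero
  | 1, _ =>
    refine hfin 1 _ ?_ (hstep 0 0 le_rfl hzero)
    rw [div_le_one hmr, Real.exp_zero]
    exact_mod_cast hm
  | 2, h =>
    have h2 : (2 : ℝ) ≤ m := by exact_mod_cast h
    refine hfin 2 _ ?_ (hstep 1 _ (by positivity) (hstep 0 0 le_rfl hzero))
    rw [div_le_one hmr, Real.exp_zero]
    have h3 : Real.exp (1 / m) ≤ Real.exp (1 / 2) := by gcongr
    have h4 : Real.exp (1 / 2) ^ 2 = Real.exp 1 := by rw [← Real.exp_nat_mul]; norm_num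
    nlinarith [Real.exp_pos (1 / 2)]
  | d + 3, h =>
    have h3 : (3 : ℝ) ≤ m := by exact_mod_cast (by omega : 3 ≤ m)
    have hall : ∀ d, ∑ s : PolicySkeleton A Z d, x ^ (toTree _ s).size ≤
        1 + 1 / Fintype.card Z := by
      intro d
      induction d with
      | zero => exact hzero.trans (by gcongr; exact zero_le_one)
      | succ d ih =>
        refine (hstep d 1 zero_le_one ih).trans ?_
        gcongr
        rw [div_le_one hmr]; linarith
    exact hfin _ 1 le_rfl (hall _)

end PolicySkeleton

/-! ### From derived trees to skeletons -/

section Despot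

variable {S A Z : Type*} (g : S → A → I → S × Z)

theorem length_tracedPath (s : S) (φ : ℕ → I) (as : List A) :
    (tracedPath g s φ as).length = as.length := by
  induction as generalizing s φ with
  | nil => rfl
  | cons a as ih => simp [tracedPath, ih]

theorem length_le_of_mem_despot {D K : ℕ} {Φ : Fin K → Scenario S} {h : List (A × Z)}
    (hh : h ∈ despot g D Φ) : h.length ≤ D := by
  obtain ⟨k, as, has, rfl⟩ := hh
  rwa [length_tracedPath]

/-- A derived policy tree has the same size and the same actions as some skeleton. -/
theorem PolicyTree.DerivedFrom.exists_skeleton [Fintype Z] {N : Set (List (A × Z))} {D : ℕ}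
    (hN : ∀ h ∈ N, h.length ≤ D) {π : PolicyTree A Z} :
    ∀ {d : ℕ} {h : List (A × Z)}, D ≤ h.length + d → π.DerivedFrom N h →
      ∃ s : PolicySkeleton A Z d, (PolicySkeleton.toTree d s).size = π.size ∧
        (PolicySkeleton.toTree d s).action? = π.action? := by
  classical
  induction π with
  | leaf =>
    intro d h _ _
    cases d with
    | zero => exact ⟨PUnit.unit, rfl, rfl⟩
    | succ d => exact ⟨none, rfl, rfl⟩
  | node a obs child ih =>
    intro d h hd hder
    obtain ⟨_, ⟨z₀, hz₀⟩, hobs, hch⟩ := hder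
    cases d with
    | zero =>
      -- An internal node at depth at least `D` would have a child deeper than `D`; this is where
      -- nonemptiness of `obs` matters.
      have := hN _ ((hobs z₀).1 hz₀)
      simp at this hd
      omega
    | succ d =>
      have hch' : ∀ z : {z // z ∈ obs}, ∃ s : PolicySkeleton A Z d,
          (PolicySkeleton.toTree d s).size = (child z).size ∧
          (PolicySkeleton.toTree d s).action? = (child z).action? :=
        fun z => ih z (by simp; omega) (hch z)
      choose f hf using hch'
      -- The filler for absent observations: a leaf adds nothing to the size and answers `none`,
      -- just as a missing edge does.
      obtain ⟨e, he⟩ : ∃ e : PolicySkeleton A Z d, PolicySkeleton.toTree d e = .leaf := by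
        cases d with
        | zero => exact ⟨PUnit.unit, rfl⟩
        | succ d => exact ⟨none, rfl⟩
      refine ⟨some (a, fun z => if hz : z ∈ obs then f ⟨z, hz⟩ else e), ?_, ?_⟩
      · simp only [PolicySkeleton.toTree, PolicyTree.size]
        congr 1
        rw [Finset.sum_coe_sort Finset.univ fun z =>
          (PolicySkeleton.toTree d (if hz : z ∈ obs then f ⟨z, hz⟩ else e)).size,
          ← Finset.sum_subset (Finset.subset_univ obs), ← Finset.sum_coe_sort obs]
        · exact Finset.sum_congr rfl fun z _ => by rw [dif_pos z.2, (hf z).1]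
        · intro z _ hz
          rw [dif_neg hz, he, PolicyTree.size]
      · funext l
        cases l with
        | nil => rfl
        | cons q l =>
          obtain ⟨b, z⟩ := q
          simp only [PolicySkeleton.toTree, PolicyTree.action?, Finset.mem_univ, dif_pos]
          split_ifs with hz
          · rw [(hf _).2]
          · rw [he, PolicyTree.action?]

end Despot
end Skeletons

/-! ### Simulation and execution have the same one-time laws -/

section Law

variable {S A Z : Type*}

instance [Countable S] [Finite A] [Finite Z] : Countable (Config S A Z) :=
  Function.Injective.countable (f := fun c : Config S A Z => (c.state, c.hist)) fun c c' h => by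
    ext1
    · exact congrArg Prod.fst h
    · exact congrArg Prod.snd h

/-- The configuration after one simulated step of the policy `p`. -/
def nextConfig (g : S → A → I → S × Z) (p : HistoryPolicy A Z) (c : Config S A Z) (u : I) :
    Config S A Z :=
  ⟨(g c.state (p c.hist) u).1, c.hist ++ [(p c.hist, (g c.state (p c.hist) u).2)]⟩

/-- `POMDP.step` as a homogeneous transition kernel. -/
noncomputable def POMDP.transition (P : POMDP S A Z) (p : HistoryPolicy A Z) :
    Kernel (Config S A Z) (Config S A Z) where
  toFun c := (P.step p c).toMeasure
  measurable' := Measurable.of_discrete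

theorem POMDP.step_apply_mk (P : POMDP S A Z) (p : HistoryPolicy A Z) (c : Config S A Z) (s : S)
    (z : Z) : P.step p c ⟨s, c.hist ++ [(p c.hist, z)]⟩ =
      P.T c.state (p c.hist) s * P.O s (p c.hist) z := by
  classical
  rw [POMDP.step, PMF.bind_apply, tsum_eq_single s]
  · rw [PMF.map_apply, tsum_eq_single z]
    · simp
    · intro z' hz'
      simp [Ne.symm hz']
  · intro s' hs'
    rw [PMF.map_apply, ENNReal.tsum_eq_zero.2]
    · simp
    · intro z'
      simp [Ne.symm hs']

theorem POMDP.step_apply_of_forall_ne (P : POMDP S A Z) (p : HistoryPolicy A Z)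
    {c c' : Config S A Z} (h : ∀ s z, (⟨s, c.hist ++ [(p c.hist, z)]⟩ : Config S A Z) ≠ c') :
    P.step p c c' = 0 := by
  rw [PMF.apply_eq_zero_iff, POMDP.step]
  simp only [PMF.mem_support_bind_iff, PMF.mem_support_map_iff]
  rintro ⟨s, _, z, _, rfl⟩
  exact h s z rfl

section Countable

variable [Countable S] [Finite A] [Finite Z] {P : POMDP S A Z} {g : S → A → I → S × Z}
  (hg : P.IsSimulativeModel g) (p : HistoryPolicy A Z)

include hg in
omit [Countable S] [Finite A] [Finite Z] in
-- A configuration extending the history by the prescribed action determines the pair `(s, z)`,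
-- where the model property applies; any other one is unreachable on both sides.
theorem POMDP.IsSimulativeModel.measurableSet_nextConfig_eq (c c' : Config S A Z) :
    MeasurableSet {u | nextConfig g p c u = c'} ∧
      volume {u | nextConfig g p c u = c'} = P.step p c c' := by
  by_cases h : ∃ s z, (⟨s, c.hist ++ [(p c.hist, z)]⟩ : Config S A Z) = c'
  · obtain ⟨s, z, rfl⟩ := h
    have : {u | nextConfig g p c u = ⟨s, c.hist ++ [(p c.hist, z)]⟩} =
        {u | g c.state (p c.hist) u = (s, z)} := by
      ext u
      simp [nextConfig, Prod.ext_iff]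
    rw [this, P.step_apply_mk]
    exact hg _ _ _ _
  · push Not at h
    have : {u | nextConfig g p c u = c'} = ∅ := by
      ext u
      simpa [nextConfig] using h _ _
    rw [this, P.step_apply_of_forall_ne p h]
    simp

include hg in
theorem POMDP.IsSimulativeModel.measurable_nextConfig (c : Config S A Z) :
    Measurable (nextConfig g p c) :=
  measurable_to_countable' fun c' => (hg.measurableSet_nextConfig_eq p c c').1

include hg in
theorem POMDP.IsSimulativeModel.map_nextConfig (c : Config S A Z) :
    (volume : Measure I).map (nextConfig g p c) = P.transition p c := by
  refine Measure.ext_of_singleton fun c' => ?_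
  rw [Measure.map_apply (hg.measurable_nextConfig p c) (measurableSet_singleton _)]
  exact (hg.measurableSet_nextConfig_eq p c c').2.trans
    (PMF.toMeasure_apply_singleton _ _ (measurableSet_singleton _)).symm

include hg in
theorem POMDP.IsSimulativeModel.measurable_uncurry_nextConfig :
    Measurable fun q : Config S A Z × I => nextConfig g p q.1 q.2 :=
  measurable_from_prod_countable_right fun c => hg.measurable_nextConfig p c

variable [MeasurableSpace S] [DiscreteMeasurableSpace S]

include hg in
theorem POMDP.IsSimulativeModel.measurable_simulate (t : ℕ) :
    Measurable fun φ : Scenario S => simulate g p φ t := by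
  induction t with
  | zero =>
    exact (Measurable.of_discrete (f := fun s : S => (⟨s, []⟩ : Config S A Z))).comp
      measurable_fst
  | succ t ih =>
    exact (hg.measurable_uncurry_nextConfig p).comp
      (ih.prodMk ((measurable_pi_apply t).comp measurable_snd))

omit [Countable S] [Finite A] [Finite Z] [MeasurableSpace S] [DiscreteMeasurableSpace S] in
theorem simulate_congr (s : S) {φ ψ : ℕ → I} {t : ℕ} (h : ∀ i < t, φ i = ψ i) :
    simulate g p (s, φ) t = simulate g p (s, ψ) t := by
  induction t with
  | zero => rfl
  | succ t ih =>
    simp only [simulate, ih fun i hi => h i (hi.trans t.lt_succ_self), h t t.lt_succ_self]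

/-- The law of one scenario for the belief `b`. -/
noncomputable abbrev singleScenarioMeasure (b : PMF S) : Measure (Scenario S) :=
  b.toMeasure.prod (Measure.infinitePi fun _ : ℕ => (volume : Measure I))

include hg in
-- The first `t` steps read only the numbers with index below `t`.
theorem POMDP.IsSimulativeModel.indepFun_simulate (s : S) (t : ℕ) :
    IndepFun (fun φ : ℕ → I => simulate g p (s, φ) t) (fun φ => φ t)
      (Measure.infinitePi fun _ : ℕ => (volume : Measure I)) := by
  have hind := (iIndepFun_infinitePi (P := fun _ : ℕ => (volume : Measure I))
    (X := fun _ u => u) fun _ => measurable_id).indepFun_finset (Finset.range t) {t}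
    (by simp) fun i => measurable_pi_apply i
  -- Padding by `0` is harmless: by `simulate_congr` the padded entries are never read.
  let ext : (Finset.range t → I) → ℕ → I := fun x i =>
    if h : i ∈ Finset.range t then x ⟨i, h⟩ else 0
  have hext : Measurable ext := by
    refine measurable_pi_lambda _ fun i => ?_
    by_cases h : i ∈ Finset.range t
    · simpa only [ext, dif_pos h] using measurable_pi_apply _
    · simpa only [ext, dif_neg h] using measurable_const
  have hlast : Measurable fun x : ({t} : Finset ℕ) → I => x ⟨t, Finset.mem_singleton_self t⟩ :=
    measurable_pi_apply _
  have := hind.comp (φ := fun x => simulate g p (s, ext x) t)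
    (ψ := fun x => x ⟨t, Finset.mem_singleton_self t⟩)
    ((hg.measurable_simulate p t).comp (measurable_const.prodMk hext)) hlast
  convert! this using 1
  funext φ
  refine simulate_congr p s fun i hi => ?_
  simp [ext, hi]

include hg in
-- Independence for each fixed start state is integrated over `b`; the law of `φ.2 t` does not
-- depend on that state, so the product form survives.
theorem POMDP.IsSimulativeModel.map_simulate_prod (b : PMF S) (t : ℕ) :
    (singleScenarioMeasure b).map (fun φ => (simulate g p φ t, φ.2 t)) =
      ((singleScenarioMeasure b).map fun φ => simulate g p φ t).prod volume := by
  have hm := hg.measurable_simulate p t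
  have ht : Measurable fun φ : Scenario S => φ.2 t :=
    (measurable_pi_apply t).comp measurable_snd
  have : IsProbabilityMeasure ((singleScenarioMeasure b).map fun φ => simulate g p φ t) :=
    Measure.isProbabilityMeasure_map hm.aemeasurable
  refine (Measure.prod_eq fun B C hB hC => ?_).symm
  rw [Measure.map_apply (hm.prodMk ht) (hB.prod hC), Measure.map_apply hm hB,
    Measure.prod_apply ((hm.prodMk ht) (hB.prod hC)), Measure.prod_apply (hm hB),
    ← lintegral_mul_const _ (measurable_measure_prodMk_left (hm hB))]
  refine lintegral_congr fun s => ?_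
  have h := (hg.indepFun_simulate p s t).measure_inter_preimage_eq_mul B C hB hC
  have hv : (Measure.infinitePi fun _ : ℕ => (volume : Measure I)) ((fun φ => φ t) ⁻¹' C) =
      volume C := by
    rw [← Measure.map_apply (measurable_pi_apply t) hC, Measure.infinitePi_map_eval]
  rw [hv] at h
  exact h

include hg in
theorem POMDP.IsSimulativeModel.map_simulate_succ (b : PMF S) (t : ℕ) :
    (singleScenarioMeasure b).map (fun φ => simulate g p φ (t + 1)) =
      ((singleScenarioMeasure b).map fun φ => simulate g p φ t).bind (P.transition p) := by
  have hm := hg.measurable_simulate p t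
  have ht : Measurable fun φ : Scenario S => φ.2 t :=
    (measurable_pi_apply t).comp measurable_snd
  have hn := hg.measurable_uncurry_nextConfig p
  have h1 : (singleScenarioMeasure b).map (fun φ => simulate g p φ (t + 1)) =
      ((singleScenarioMeasure b).map (fun φ => (simulate g p φ t, φ.2 t))).map
        fun q => nextConfig g p q.1 q.2 := by
    rw [Measure.map_map hn (hm.prodMk ht)]
    rfl
  rw [h1, hg.map_simulate_prod]
  ext B hB
  rw [Measure.map_apply hn hB, Measure.prod_apply (hn hB),
    Measure.bind_apply hB (P.transition p).aemeasurable]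
  refine lintegral_congr fun c => ?_
  rw [← hg.map_nextConfig p c, Measure.map_apply (hg.measurable_nextConfig p c) hB]
  rfl

end Countable

theorem POMDP.map_execution_zero (P : POMDP S A Z) (p : HistoryPolicy A Z) (b : PMF S) :
    (P.execution p b).map (fun ω => ω 0) =
      (b.map fun s => (⟨s, []⟩ : Config S A Z)).toMeasure := by
  have h0 : Measurable fun x : (Finset.Iic 0) → Config S A Z => x ⟨0, by simp⟩ :=
    measurable_pi_apply _
  have hpi := (MeasurableEquiv.piUnique fun _ : Finset.Iic 0 => Config S A Z).symm.measurable
  have h1 : (P.execution p b).map (fun ω => ω 0) =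
      ((P.execution p b).map (Preorder.frestrictLe 0)).map fun x => x ⟨0, by simp⟩ := by
    rw [Measure.map_map h0 (by fun_prop)]
    rfl
  rw [h1, POMDP.execution, Kernel.trajMeasure, Measure.map_comp _ _ (by fun_prop),
    Kernel.traj_map_frestrictLe, Kernel.partialTraj_self, Measure.id_comp,
    Measure.map_map h0 hpi]
  exact Measure.map_id

theorem POMDP.map_execution_succ (P : POMDP S A Z) (p : HistoryPolicy A Z) (b : PMF S) (t : ℕ) :
    (P.execution p b).map (fun ω => ω (t + 1)) =
      ((P.execution p b).map fun ω => ω t).bind (P.transition p) := by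
  -- The second marginal of the joint law of the past and the next configuration. The step kernel
  -- reads only the last entry of the past, so the past collapses to time `t`.
  have h := congrArg Measure.snd (Kernel.map_frestrictLe_trajMeasure_compProd_eq_map_trajMeasure
    (X := fun _ => Config S A Z)
    (μ₀ := (b.map fun s => (⟨s, []⟩ : Config S A Z)).toMeasure) (κ := P.stepKernel p) (a := t))
  rw [Measure.snd_compProd, Measure.snd_map_prodMk (by fun_prop)] at h
  refine h.symm.trans ?_
  ext B hB
  rw [Measure.bind_apply hB (P.stepKernel p t).aemeasurable,
    Measure.bind_apply hB (P.transition p).aemeasurable,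
    lintegral_map ((P.stepKernel p t).measurable_coe hB) (by fun_prop),
    lintegral_map ((P.transition p).measurable_coe hB) (by fun_prop)]
  rfl

instance (P : POMDP S A Z) (p : HistoryPolicy A Z) (b : PMF S) :
    IsProbabilityMeasure (P.execution p b) :=
  inferInstanceAs (IsProbabilityMeasure (Kernel.trajMeasure (X := fun _ => Config S A Z) _ _))

/-! ### The value as the mean of the scenario value -/

section Value

variable [Countable S] [Finite A] [Finite Z] {P : POMDP S A Z} {g : S → A → I → S × Z}
  (hg : P.IsSimulativeModel g) (p : HistoryPolicy A Z)
  [MeasurableSpace S] [DiscreteMeasurableSpace S]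

include hg in
/-- At each time, simulation under a random scenario has the same law as execution. -/
theorem POMDP.IsSimulativeModel.map_simulate_eq_map_execution (b : PMF S) (t : ℕ) :
    (singleScenarioMeasure b).map (fun φ => simulate g p φ t) =
      (P.execution p b).map fun ω => ω t := by
  induction t with
  | zero =>
    have hs : Measurable fun s : S => (⟨s, []⟩ : Config S A Z) := Measurable.of_discrete
    have h1 : (singleScenarioMeasure b).map (fun φ => simulate g p φ 0) =
        ((singleScenarioMeasure b).map Prod.fst).map fun s => (⟨s, []⟩ : Config S A Z) := by
      rw [Measure.map_map hs measurable_fst]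
      rfl
    rw [P.map_execution_zero, h1, Measure.map_fst_prod, measure_univ, one_smul,
      PMF.toMeasure_map (p := b) (hf := hs)]
  | succ t ih => rw [hg.map_simulate_succ, P.map_execution_succ, ih]

omit [Countable S] [Finite A] [Finite Z] [MeasurableSpace S] [DiscreteMeasurableSpace S] in
theorem norm_discounted_le {γ : ℝ} (hγ₀ : 0 ≤ γ) {Rmax r : ℝ} (hr : 0 ≤ r ∧ r ≤ Rmax) (t : ℕ) :
    ‖γ ^ t * r‖ ≤ γ ^ t * Rmax := by
  rw [Real.norm_eq_abs, abs_of_nonneg (mul_nonneg (pow_nonneg hγ₀ t) hr.1)]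
  exact mul_le_mul_of_nonneg_left hr.2 (pow_nonneg hγ₀ t)

/-- The expectation of a discounted sum of bounded variables is the discounted sum of the
expectations. -/
theorem integral_tsum_discounted {Ω : Type*} [MeasurableSpace Ω] (μ : Measure Ω)
    [IsProbabilityMeasure μ] {γ : ℝ} (hγ₀ : 0 ≤ γ) (hγ₁ : γ < 1) {Rmax : ℝ} {r : ℕ → Ω → ℝ}
    (hm : ∀ t, Measurable (r t)) (hr : ∀ t ω, 0 ≤ r t ω ∧ r t ω ≤ Rmax) :
    ∫ ω, ∑' t, γ ^ t * r t ω ∂μ = ∑' t, ∫ ω, γ ^ t * r t ω ∂μ := by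
  have hi : ∀ t, Integrable (fun ω => γ ^ t * r t ω) μ := fun t =>
    Integrable.of_bound ((hm t).const_mul _).aestronglyMeasurable (γ ^ t * Rmax)
      (ae_of_all _ fun ω => norm_discounted_le hγ₀ (hr t ω) t)
  refine (integral_tsum_of_summable_integral_norm hi ?_).symm
  refine Summable.of_nonneg_of_le (fun t => integral_nonneg fun ω => norm_nonneg _) (fun t => ?_)
    ((summable_geometric_of_lt_one hγ₀ hγ₁).mul_right Rmax)
  calc ∫ ω, ‖γ ^ t * r t ω‖ ∂μ ≤ ∫ _ω, γ ^ t * Rmax ∂μ :=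
        integral_mono (hi t).norm (integrable_const _)
          fun ω => norm_discounted_le hγ₀ (hr t ω) t
    _ = γ ^ t * Rmax := by simp

variable {γ : ℝ} (hγ₀ : 0 ≤ γ) (hγ₁ : γ < 1) {Rmax : ℝ} (hR : ∀ s a, 0 ≤ P.R s a ∧ P.R s a ≤ Rmax)

include hg hγ₀ hγ₁ hR in
/-- The value of a policy is the expected discounted reward of its simulation. -/
theorem POMDP.IsSimulativeModel.integral_scenarioValue (b : PMF S) :
    ∫ φ, scenarioValue g P.R γ p φ ∂(singleScenarioMeasure b) = P.value p γ b := by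
  have hr : Measurable fun c : Config S A Z => P.R c.state (p c.hist) := Measurable.of_discrete
  unfold scenarioValue POMDP.value
  rw [integral_tsum_discounted (r := fun t φ => P.R (simulate g p φ t).state
      (p (simulate g p φ t).hist)) _ hγ₀ hγ₁ (fun t => hr.comp (hg.measurable_simulate p t))
      (fun _ _ => hR _ _),
    integral_tsum_discounted (r := fun t (ω : ℕ → Config S A Z) => P.R (ω t).state (p (ω t).hist)) _ hγ₀ hγ₁
      (fun t => hr.comp (measurable_pi_apply t)) (fun _ _ => hR _ _)]
  -- Each summand involves a single time, so equality of one-time marginals suffices.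
  refine tsum_congr fun t => ?_
  have h := hg.map_simulate_eq_map_execution p b t
  have hf : Measurable fun c : Config S A Z => γ ^ t * P.R c.state (p c.hist) :=
    Measurable.of_discrete
  have h1 := integral_map (μ := singleScenarioMeasure b)
    (hg.measurable_simulate p t).aemeasurable hf.aestronglyMeasurable
  have h2 := integral_map (μ := P.execution p b) (φ := fun ω => ω t)
    (measurable_pi_apply t).aemeasurable hf.aestronglyMeasurable
  rw [← h1, ← h2, h]

include hg in
theorem POMDP.IsSimulativeModel.measurable_scenarioValue (γ : ℝ) :
    Measurable (scenarioValue g P.R γ p) := by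
  have hr : Measurable fun c : Config S A Z => P.R c.state (p c.hist) := Measurable.of_discrete
  exact Measurable.tsum fun t => (hr.comp (hg.measurable_simulate p t)).const_mul _

omit [Countable S] [Finite A] [Finite Z] [MeasurableSpace S] [DiscreteMeasurableSpace S]

include hγ₀ hR in
theorem scenarioValue_nonneg (φ : Scenario S) : 0 ≤ scenarioValue g P.R γ p φ :=
  tsum_nonneg fun t => mul_nonneg (pow_nonneg hγ₀ t) (hR _ _).1

include hγ₀ hγ₁ hR in
theorem scenarioValue_le (φ : Scenario S) : scenarioValue g P.R γ p φ ≤ Rmax / (1 - γ) := by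
  have hs := (summable_geometric_of_lt_one hγ₀ hγ₁).mul_right Rmax
  calc scenarioValue g P.R γ p φ ≤ ∑' t : ℕ, γ ^ t * Rmax :=
        Summable.tsum_le_tsum (fun t => (le_abs_self _).trans (norm_discounted_le hγ₀ (hR _ _) t))
          (Summable.of_norm_bounded hs fun t => norm_discounted_le hγ₀ (hR _ _) t) hs
    _ = Rmax / (1 - γ) := by
        rw [tsum_mul_right, tsum_geometric_of_lt_one hγ₀ hγ₁]; ring

end Value
end Law

/-! ### Deviation bound for one fixed policy -/

section Uniform

variable {S A Z : Type*} [Countable S] [MeasurableSpace S] [DiscreteMeasurableSpace S]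
  [Finite A] [Finite Z] {P : POMDP S A Z} {γ : ℝ} (hγ₀ : 0 ≤ γ) (hγ₁ : γ < 1) {Rmax : ℝ}
  (hR : ∀ s a, 0 ≤ P.R s a ∧ P.R s a ≤ Rmax) {g : S → A → I → S × Z}
  (hg : P.IsSimulativeModel g)

instance (b : PMF S) (K : ℕ) : IsProbabilityMeasure (scenarioMeasure b K) :=
  inferInstanceAs (IsProbabilityMeasure (Measure.pi _))

include hg in
theorem POMDP.IsSimulativeModel.measurable_empiricalValue (p : HistoryPolicy A Z) (K : ℕ) :
    Measurable fun Φ : Fin K → Scenario S => empiricalValue g P.R γ p Φ :=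
  (Finset.measurable_sum _ fun k _ =>
    (hg.measurable_scenarioValue p γ).comp (measurable_pi_apply k)).div_const _

include hγ₀ hγ₁ hR hg in
/-- For a fixed policy, its value is rarely much below its empirical value. -/
theorem POMDP.IsSimulativeModel.scenarioMeasure_value_lt_le (p : HistoryPolicy A Z) (b : PMF S)
    {K : ℕ} (hK : 0 < K) {α : ℝ} (hα : α ∈ Set.Ioo (0 : ℝ) 1) {L : ℝ} (hL : 0 ≤ L) :
    scenarioMeasure b K {Φ | P.value p γ b < (1 - α) / (1 + α) * empiricalValue g P.R γ p Φ -
        Rmax / ((1 + α) * (1 - γ)) * (L / (α * K))} ≤ ENNReal.ofReal (Real.exp (-L)) := by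
  have hα0 := hα.1
  have h1γ : 0 < 1 - γ := by linarith
  have hval := hg.integral_scenarioValue p hγ₀ hγ₁ hR b
  have hM : 0 ≤ Rmax := by
    obtain ⟨s, _⟩ := b.support_nonempty
    exact (hR s (p [])).1.trans (hR s (p [])).2
  -- The deviation bound needs a positive range; for `Rmax = 0` all values vanish and the bad event
  -- is empty.
  rcases hM.eq_or_lt with rfl | hM
  · have hz : ∀ φ, scenarioValue g P.R γ p φ = 0 := fun φ =>
      le_antisymm ((scenarioValue_le p hγ₀ hγ₁ hR φ).trans_eq (zero_div _))
        (scenarioValue_nonneg p hγ₀ hR φ)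
    rw [← hval]
    simp [empiricalValue, hz]
  · refine le_trans (measure_mono fun Φ hΦ => ?_)
      (measure_pi_relative_deviation_le (singleScenarioMeasure b)
        (hg.measurable_scenarioValue p γ) (div_pos hM h1γ) (scenarioValue_nonneg p hγ₀ hR)
        (scenarioValue_le p hγ₀ hγ₁ hR) hK hα hL)
    simp only [Set.mem_ofPred_eq] at hΦ ⊢
    rw [hval]
    have h := mul_lt_mul_of_pos_left hΦ (show 0 < 1 + α by linarith)
    convert! h using 1
    rw [empiricalValue]
    field_simp

end Uniform

/-! ### Union bound over skeletons -/

theorem theorem1 {S A Z : Type*} [Countable S] [MeasurableSpace S] [DiscreteMeasurableSpace S]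
    [Fintype A] [Fintype Z] (P : POMDP S A Z) (γ : ℝ) (hγ₀ : 0 ≤ γ) (hγ₁ : γ < 1)
    (Rmax : ℝ) (hR : ∀ s a, 0 ≤ P.R s a ∧ P.R s a ≤ Rmax)
    (g : S → A → I → S × Z) (hg : P.IsSimulativeModel g) (δ : HistoryPolicy A Z)
    (τ α : ℝ) (hτ : τ ∈ Set.Ioo (0 : ℝ) 1) (hα : α ∈ Set.Ioo (0 : ℝ) 1)
    (b₀ : PMF S) (D K : ℕ) (hD : 0 < D) (hK : 0 < K) :
    ENNReal.ofReal (1 - τ) ≤ scenarioMeasure b₀ K {Φ | ∀ π ∈ despotPolicies g b₀ D K,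
      P.value (π.toPolicy δ) γ b₀ ≥
        (1 - α) / (1 + α) * empiricalValue g P.R γ (π.toPolicy δ) Φ -
          Rmax / ((1 + α) * (1 - γ)) *
            ((Real.log (4 / τ) +
                (π.size : ℝ) * Real.log (K * D * Fintype.card A * Fintype.card Z)) /
              (α * K))} := by
  obtain ⟨hτ0, hτ1⟩ := hτ
  have : Nonempty A := ⟨δ []⟩
  have : Nonempty Z := by
    obtain ⟨s, _⟩ := b₀.support_nonempty
    obtain ⟨z, _⟩ := (P.O s (δ [])).support_nonempty
    exact ⟨z⟩
  set N : ℝ := K * D * Fintype.card A * Fintype.card Z with hN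
  have hN1 : 1 ≤ N := by
    have : 1 ≤ K * D * Fintype.card A * Fintype.card Z :=
      Nat.one_le_iff_ne_zero.2 (by positivity)
    rw [hN]
    exact_mod_cast this
  have hN0 : 0 < N := by linarith
  let L : PolicyTree A Z → ℝ := fun π => Real.log (4 / τ) + (π.size : ℝ) * Real.log N
  have hL0 : ∀ π, 0 ≤ L π := fun π => add_nonneg
    (Real.log_nonneg (by rw [le_div_iff₀ hτ0]; linarith))
    (mul_nonneg (Nat.cast_nonneg _) (Real.log_nonneg hN1))
  have hLexp : ∀ π, Real.exp (-L π) = τ / 4 * (1 / N) ^ π.size := fun π => by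
    rw [Real.exp_neg, Real.exp_add, Real.exp_log (by positivity), Real.exp_nat_mul,
      Real.exp_log hN0, mul_inv, inv_div, one_div, inv_pow]
  let bad : PolicyTree A Z → Set (Fin K → Scenario S) := fun π =>
    {Φ | P.value (π.toPolicy δ) γ b₀ <
      (1 - α) / (1 + α) * empiricalValue g P.R γ (π.toPolicy δ) Φ -
        Rmax / ((1 + α) * (1 - γ)) * (L π / (α * K))}
  have hbad : ∀ π, scenarioMeasure b₀ K (bad π) ≤ ENNReal.ofReal (τ / 4 * (1 / N) ^ π.size) :=
    fun π => (hg.scenarioMeasure_value_lt_le hγ₀ hγ₁ hR (π.toPolicy δ) b₀ hK hα (hL0 π)).trans_eq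
      (by rw [hLexp])
  have hmeas : ∀ π, MeasurableSet (bad π) := fun π => measurableSet_lt measurable_const
    (((hg.measurable_empiricalValue _ K).const_mul _).sub_const _)
  let U : Set (Fin K → Scenario S) :=
    ⋃ s : PolicySkeleton A Z D, bad (PolicySkeleton.toTree D s)
  have hU : scenarioMeasure b₀ K U ≤ ENNReal.ofReal τ := by
    calc scenarioMeasure b₀ K U
        ≤ ∑ s : PolicySkeleton A Z D, scenarioMeasure b₀ K (bad (PolicySkeleton.toTree D s)) :=
          measure_iUnion_fintype_le _ _
      _ ≤ ∑ s : PolicySkeleton A Z D,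
            ENNReal.ofReal (τ / 4 * (1 / N) ^ (PolicySkeleton.toTree D s).size) :=
          Finset.sum_le_sum fun s _ => hbad _
      _ = ENNReal.ofReal (∑ s : PolicySkeleton A Z D,
            τ / 4 * (1 / N) ^ (PolicySkeleton.toTree D s).size) :=
          (ENNReal.ofReal_sum_of_nonneg fun s _ => by positivity).symm
      _ ≤ ENNReal.ofReal τ := by
          refine ENNReal.ofReal_le_ofReal ?_
          rw [← Finset.mul_sum]
          have := PolicySkeleton.sum_pow_size_le (A := A) (Z := Z) (mul_pos hK hD)
            (Nat.le_mul_of_pos_left D hK)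
          rw [Nat.cast_mul, ← hN] at this
          -- The sum is at most `τ / 4 * 2`, half of what is allowed.
          nlinarith
  calc ENNReal.ofReal (1 - τ) = 1 - ENNReal.ofReal τ := by
        rw [ENNReal.ofReal_sub _ hτ0.le, ENNReal.ofReal_one]
    _ ≤ 1 - scenarioMeasure b₀ K U := tsub_le_tsub_left hU 1
    _ = scenarioMeasure b₀ K Uᶜ :=
        (prob_compl_eq_one_sub (MeasurableSet.iUnion fun s => hmeas _)).symm
    _ ≤ _ := by
        refine measure_mono fun Φ hΦ => ?_
        rw [Set.mem_ofPred_eq]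
        intro π hπ
        obtain ⟨Ψ, _, hder⟩ := hπ
        -- The skeleton shares size and policy with `π`, so avoiding its bad event is exactly the
        -- claim for `π`.
        obtain ⟨s, hs, ha⟩ := hder.exists_skeleton (fun h hh => length_le_of_mem_despot g hh)
          (d := D) (by simp)
        have hΦs : Φ ∉ bad (PolicySkeleton.toTree D s) :=
          fun h => hΦ (Set.mem_iUnion.2 ⟨s, h⟩)
        have hpol : (PolicySkeleton.toTree D s).toPolicy δ = π.toPolicy δ := by
          funext h
          rw [PolicyTree.toPolicy, ha, PolicyTree.toPolicy]
        simp only [bad, L, Set.mem_ofPred_eq, not_lt, hpol, hs] at hΦs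
        exact hΦs
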